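/- **Setting.** A De Morgan algebra is a bounded distributive lattice $\mathfrak M=\langle M,+,\cdot,-,0,1\rangle$ with a unary operation $-$ such that $-(x+y)=-x\cdot -y$, $-(x\cdot y)=-x+-y$ and $--x=x$. Let $\mathfrak M$ be a finite De Morgan algebra with $0\neq 1$, let $\alpha$ be an ordinal, and let $p,q,r$ range over $M$ and $\kappa,\lambda,\mu$ over the ordinals below $\alpha$. A $\mathrm{CA}_\alpha$ is a cylindric algebra of dimension $\alpha$. A $\mathrm{CSA}_\alpha$ with base $U$ is a subalgebra of the full cylindric set algebra on $\mathcal P(U^\alpha)$. A $\mathrm{CA}_\alpha$ is *representable* if it is isomorphic to a subdirect product of $\mathrm{CSA}_\alpha$'s. An $\mathfrak M$-$\mathrm{CA}_\alpha$ is an algebra $\langle A,+,\cdot,-,u_p,c_\kappa,d_{\kappa\lambda},\delta_p\rangle_{\kappa,\lambda<\alpha,\,p\in M}$ such that - $+$ and $\cdot$ are commutative and associative and distribute over each other; $a+u_0=a$; $a\cdot u_1=a$; $\delta_pa+-\delta_pa=u_1$; $\delta_pa\cdot-\delta_pa=u_0$; - $c_\kappa u_0=u_0$; $a+c_\kappa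 a=c_\kappa a$; $c_\kappa(a\cdot c_\kappa b)=c_\kappa a\cdot c_\kappa b$; $c_\kappa c_\lambda a=c_\lambda c_\kappa a$; $d_{\lambda\mu}=c_\kappa(d_{\lambda\kappa}\cdot d_{\kappa\mu})$ for $\kappa\ne\lambda,\mu$; $d_{\kappa\kappa}=u_1$; $c_\kappa(d_{\kappa\lambda}\cdot\delta_1a)\cdot c_\kappa(d_{\kappa\lambda}\cdot-\delta_1a)=u_0$ for $\kappa\ne\lambda$; - $\delta_1(\delta_1a+\delta_1b)=\delta_1a+\delta_1b$; $\delta_1(\delta_1a\cdot\delta_1b)=\delta_1a\cdot\delta_1b$; $\delta_1{-}\delta_1a=-\delta_1a$; $\delta_1c_\kappa\delta_1a=c_\kappa\delta_1a$; $\delta_1d_{\kappa\lambda}=d_{\kappa\lambda}$; $\delta_0d_{\kappa\lambda}=-d_{\kappa\lambda}$; $\delta_pd_{\kappa\lambda}=u_0$ for $p\ne0,1$; $\delta_p(-a)=\delta_{-p}a$; $\delta_pu_p=u_1$; $\delta_pu_q=u_0$ and $\delta_pa\cdot\delta_qa=u_0$ for $p\neq q$; $\sum_{p\in M}\delta_pa=u_1$;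 $\delta_p(a+b)=\sum_{q+r=p}\delta_qa\cdot\delta_rb$; $\delta_p(a\cdot b)=\sum_{q\cdot r=p}\delta_qa\cdot\delta_rb$; $\delta_1\delta_qa=\delta_qa$; $\delta_p\delta_qa=u_0$ for $p\ne0,1$; $\delta_0\delta_qa=-\delta_qa$; if $\delta_pa=\delta_pb$ for all $p$, then $a=b$; - $\delta_pc_\kappa a=\Big(\sum_{\sup Q=p}\prod_{q\in Q}c_\kappa\delta_qa\Big)\cdot-\Big(\sum_{\sup Q>p}\prod_{q\in Q}c_\kappa\delta_qa\Big)$, where $Q$ ranges over the nonempty subsets of $M$. For a $\mathrm{CA}_\alpha$ $\mathfrak B$, the algebra $\mathfrak M(\mathfrak B)$ has as universe the set of all $x\in B^M$ with $x^p\cdot x^q=0$ for $p\ne q$ and $\sum_{p\in M}x^p=1$, and the operations $(x+y)^p=\sum_{q+r=p}x^q\cdot y^r$, $(x\cdot y)^p=\sum_{q\cdot r=p}x^q\cdot y^r$, $(-x)^p=x^{-p}$, $(u_q)^p=1$ if $p=q$ and $0$ otherwise, $(c_\kappa x)^p=\big(\sum_{\sup Q=p}\prod_{q\in Q}c_\kappa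 x^q\big)\cdot-\big(\sum_{\sup Q>p}\prod_{q\in Q}c_\kappa x^q\big)$ ($\emptyset\ne Q\subseteq M$), while $d_{\kappa\lambda}$ takes the values $d_{\kappa\lambda}$ at $1$, $-d_{\kappa\lambda}$ at $0$ and $0$ elsewhere, and $\delta_qx$ takes the values $x^q$ at $1$, $-x^q$ at $0$ and $0$ elsewhere. An $\mathfrak M$-$\mathrm{CSA}_\alpha$ is a subalgebra of $\mathfrak M(\mathfrak B)$ for some $\mathrm{CSA}_\alpha$ $\mathfrak B$. An $\mathfrak M$-$\mathrm{CA}_\alpha$ is *representable* if it is isomorphic to a subdirect product of $\mathfrak M$-$\mathrm{CSA}_\alpha$'s. **Statement.** For every non-representable $\mathrm{CA}_\alpha$ $\mathfrak B$, the algebra $\mathfrak M(\mathfrak B)$ is a non-representable $\mathfrak M$-$\mathrm{CA}_\alpha$. If $\alpha\ge2$, then there is a non-representable $\mathrm{CA}_\alpha$ $\mathfrak B$ such that $\mathfrak M(\mathfrak B)$ is a non-representable $\mathfrak M$-$\mathrm{CA}_\alpha$; in particular, there exists a non-representable $\mathfrak M$-$\mathrm{CA}_\alpha$. -/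

import Mathlib

universe u

/-! ### De Morgan algebras -/

/-- A De Morgan algebra: a bounded distributive lattice with an involution satisfying the
De Morgan laws. Here `⊔, ⊓, ᶜ, ⊥, ⊤` are the operations `+, ·, -, 0, 1`, and `p ≤ q` iff
`p ⊓ q = p`. -/
class DeMorganAlgebra (M : Type u) extends DistribLattice M, BoundedOrder M, Compl M where
  neg_neg : ∀ p : M, pᶜᶜ = p
  neg_sup : ∀ p q : M, (p ⊔ q)ᶜ = pᶜ ⊓ qᶜ
  neg_inf : ∀ p q : M, (p ⊓ q)ᶜ = pᶜ ⊔ qᶜ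

/-! ### Cylindric algebras, cylindric set algebras, representability -/

/-- Cylindric algebras whose dimension is the index set `ι` (for `CA_α` take
`ι = α.ToType`, the well-ordered set of the ordinals below `α`). -/
class CylindricAlgebra (ι : Type u) (B : Type u) [BooleanAlgebra B] where
  /-- cylindrifications -/
  c : ι → B → B
  /-- diagonal elements -/
  d : ι → ι → B
  c_bot : ∀ κ, c κ ⊥ = ⊥
  le_c : ∀ κ x, x ≤ c κ x
  c_inf_c : ∀ κ x y, c κ (x ⊓ c κ y) = c κ x ⊓ c κ y
  c_comm : ∀ κ l x, c κ (c l x) = c l (c κ x)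
  d_self : ∀ κ, d κ κ = ⊤
  d_trans : ∀ κ l m, κ ≠ l → κ ≠ m → d l m = c κ (d l κ ⊓ d κ m)
  c_d_inf : ∀ κ l x, κ ≠ l → c κ (d κ l ⊓ x) ⊓ c κ (d κ l ⊓ xᶜ) = ⊥

open Classical in
/-- The full cylindric set algebra with base `U`: all subsets of `U^ι`, with
`C_κ X = {s | s(κ/x) ∈ X for some x ∈ U}` and `D_κλ = {s | s_κ = s_λ}`. -/
instance fullCylindricSetAlgebra (ι U : Type u) : CylindricAlgebra ι (Set (ι → U)) where
  c κ X := {s | ∃ x : U, Function.update s κ x ∈ X}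
  d κ l := {s | s κ = s l}
  c_bot κ := by ext s; simp
  le_c κ X := fun s hs => ⟨s κ, by simpa using hs⟩
  c_inf_c κ X Y := by ext s; simp
  c_comm κ l X := by
    by_cases h : κ = l
    · subst h; rfl
    · ext s
      constructor
      · rintro ⟨x, y, hs⟩
        exact ⟨y, x, by rwa [Function.update_comm h] at hs⟩
      · rintro ⟨x, y, hs⟩
        exact ⟨y, x, by rwa [Function.update_comm (Ne.symm h)] at hs⟩
  d_self κ := by ext s; simp
  d_trans κ l m hl hm := by
    ext s
    simp [Function.update_of_ne hl.symm, Function.update_of_ne hm.symm]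
  c_d_inf κ l X h := by
    ext s
    simp only [Set.inf_eq_inter, Set.mem_inter_iff, Set.mem_ofPred_eq, Set.bot_eq_empty,
      Set.mem_empty_iff_false, Set.mem_compl_iff, Function.update_self,
      Function.update_of_ne h.symm, iff_false]
    rintro ⟨⟨x, rfl, h1⟩, ⟨y, rfl, h2⟩⟩
    exact h2 h1

/-- Subalgebras of a cylindric algebra. -/
structure CylindricSubalgebra (ι : Type u) (B : Type u) [BooleanAlgebra B]
    [CylindricAlgebra ι B] where
  /-- the underlying Boolean subalgebra -/
  toBool : BooleanSubalgebra B
  c_mem : ∀ (κ : ι) (x : B), x ∈ toBool → CylindricAlgebra.c κ x ∈ toBool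
  d_mem : ∀ κ l : ι, CylindricAlgebra.d κ l ∈ toBool

/-- The universe of a subalgebra, as a type. -/
abbrev CylindricSubalgebra.Carrier {ι B : Type u} [BooleanAlgebra B] [CylindricAlgebra ι B]
    (S : CylindricSubalgebra ι B) : Type u := S.toBool

/-- A subalgebra of a cylindric algebra is a cylindric algebra under the restricted operations. -/
instance CylindricSubalgebra.cylindricAlgebra {ι B : Type u} [BooleanAlgebra B]
    [CylindricAlgebra ι B] (S : CylindricSubalgebra ι B) : CylindricAlgebra ι S.Carrier where
  c κ x := ⟨CylindricAlgebra.c κ x.1, S.c_mem κ x.1 x.2⟩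
  d κ l := ⟨CylindricAlgebra.d κ l, S.d_mem κ l⟩
  c_bot κ := Subtype.ext (CylindricAlgebra.c_bot κ)
  le_c κ x := CylindricAlgebra.le_c κ x.1
  c_inf_c κ x y := Subtype.ext (CylindricAlgebra.c_inf_c κ x.1 y.1)
  c_comm κ l x := Subtype.ext (CylindricAlgebra.c_comm κ l x.1)
  d_self κ := Subtype.ext (CylindricAlgebra.d_self κ)
  d_trans κ l m hl hm := Subtype.ext (CylindricAlgebra.d_trans κ l m hl hm)
  c_d_inf κ l x h := Subtype.ext (CylindricAlgebra.c_d_inf κ l x.1 h)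

/-- A cylindric set algebra with base `U` is a subalgebra of the full one. -/
abbrev CylindricSetAlgebra (ι U : Type u) : Type u := CylindricSubalgebra ι (Set (ι → U))

/-- Homomorphisms of cylindric algebras (complements are preserved automatically). -/
structure CylindricHom (ι B C : Type u) [BooleanAlgebra B] [CylindricAlgebra ι B]
    [BooleanAlgebra C] [CylindricAlgebra ι C] extends BoundedLatticeHom B C where
  map_c : ∀ (κ : ι) (x : B),
    toFun (CylindricAlgebra.c κ x) = CylindricAlgebra.c κ (toFun x)
  map_d : ∀ κ l : ι, toFun (CylindricAlgebra.d κ l) = CylindricAlgebra.d κ l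

/-- `B` is representable: it is isomorphic to a subdirect product of cylindric set algebras,
i.e. there is a jointly injective family of surjective homomorphisms onto set algebras. -/
def IsRepresentableCA (ι B : Type u) [BooleanAlgebra B] [CylindricAlgebra ι B] : Prop :=
  ∃ (J : Type u) (U : J → Type u) (S : ∀ j, CylindricSetAlgebra ι (U j))
    (h : ∀ j, CylindricHom ι B (S j).Carrier),
    (∀ j, Function.Surjective (h j).toFun) ∧
    (∀ x y : B, (∀ j, (h j).toFun x = (h j).toFun y) → x = y)

/-! ### `M`-cylindric algebras -/

/-- Algebras of the similarity type of `M`-cylindric algebras of dimension `ι`. -/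
structure MCylindricStr (M ι : Type u) where
  carrier : Type u
  add : carrier → carrier → carrier
  mul : carrier → carrier → carrier
  neg : carrier → carrier
  u : M → carrier
  c : ι → carrier → carrier
  d : ι → ι → carrier
  δ : M → carrier → carrier

namespace MCylindricStr

variable {M ι : Type u}

instance (A : MCylindricStr M ι) : Add A.carrier := ⟨A.add⟩
instance (A : MCylindricStr M ι) : Mul A.carrier := ⟨A.mul⟩
instance (A : MCylindricStr M ι) : Neg A.carrier := ⟨A.neg⟩

/-- The axioms on `+`, `·`, `u_0`, `u_1` alone; they make finite sums and products meaningful. -/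
structure IsBase [DeMorganAlgebra M] (A : MCylindricStr M ι) : Prop where
  add_comm : ∀ a b : A.carrier, a + b = b + a
  mul_comm : ∀ a b : A.carrier, a * b = b * a
  add_assoc : ∀ a b e : A.carrier, (a + b) + e = a + (b + e)
  mul_assoc : ∀ a b e : A.carrier, (a * b) * e = a * (b * e)
  mul_add : ∀ a b e : A.carrier, a * (b + e) = a * b + a * e
  add_mul_distrib : ∀ a b e : A.carrier, a + b * e = (a + b) * (a + e)
  add_zero : ∀ a : A.carrier, a + A.u ⊥ = a
  mul_one : ∀ a : A.carrier, a * A.u ⊤ = a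

namespace IsBase

variable [DeMorganAlgebra M] {A : MCylindricStr M ι}

/-- The commutative monoid `(A, +, u_0)`. -/
abbrev addCommMonoid (hA : A.IsBase) : AddCommMonoid A.carrier where
  add_assoc := hA.add_assoc
  add_comm := hA.add_comm
  zero := A.u ⊥
  add_zero := hA.add_zero
  zero_add a := (hA.add_comm _ _).trans (hA.add_zero a)
  nsmul := @nsmulRec A.carrier ⟨A.u ⊥⟩ _

/-- The commutative monoid `(A, ·, u_1)`. -/
abbrev commMonoid (hA : A.IsBase) : CommMonoid A.carrier where
  mul_assoc := hA.mul_assoc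
  mul_comm := hA.mul_comm
  one := A.u ⊤
  mul_one := hA.mul_one
  one_mul a := (hA.mul_comm _ _).trans (hA.mul_one a)
  npow := @npowRec A.carrier ⟨A.u ⊤⟩ _

/-- Finite sums in `A`; the empty sum is `u_0`. -/
def sum (hA : A.IsBase) {X : Type u} (s : Finset X) (f : X → A.carrier) : A.carrier :=
  letI := hA.addCommMonoid
  ∑ x ∈ s, f x

/-- Finite products in `A`; the empty product is `u_1`. -/
def prod (hA : A.IsBase) {X : Type u} (s : Finset X) (f : X → A.carrier) : A.carrier :=
  letI := hA.commMonoid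
  ∏ x ∈ s, f x

end IsBase

end MCylindricStr

section IndexSets

variable {M : Type u} [DeMorganAlgebra M] [Fintype M]

open Classical in
/-- Pairs `(q, r)` with `q + r = p`. -/
noncomputable def supPairs (p : M) : Finset (M × M) := {z | z.1 ⊔ z.2 = p}

open Classical in
/-- Pairs `(q, r)` with `q · r = p`. -/
noncomputable def infPairs (p : M) : Finset (M × M) := {z | z.1 ⊓ z.2 = p}

open Classical in
/-- Nonempty `A ⊆ M` with `sup A = p`. -/
noncomputable def supEq (p : M) : Finset (Finset M) := {A | A.Nonempty ∧ A.sup id = p}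

open Classical in
/-- Nonempty `A ⊆ M` with `sup A > p`. -/
noncomputable def supGt (p : M) : Finset (Finset M) := {A | A.Nonempty ∧ p < A.sup id}

end IndexSets

/-- `A` is an `M`-cylindric algebra of dimension `ι`. -/
structure MCylindricStr.IsMCylindricAlgebra {M ι : Type u} [DeMorganAlgebra M] [Fintype M]
    (A : MCylindricStr M ι) : Prop extends base : A.IsBase where
  δ_add_neg : ∀ (p : M) (a : A.carrier), A.δ p a + -A.δ p a = A.u ⊤
  δ_mul_neg : ∀ (p : M) (a : A.carrier), A.δ p a * -A.δ p a = A.u ⊥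
  c_zero : ∀ κ, A.c κ (A.u ⊥) = A.u ⊥
  add_c : ∀ κ (a : A.carrier), a + A.c κ a = A.c κ a
  c_mul_c : ∀ κ (a b : A.carrier), A.c κ (a * A.c κ b) = A.c κ a * A.c κ b
  c_comm : ∀ κ l (a : A.carrier), A.c κ (A.c l a) = A.c l (A.c κ a)
  d_trans : ∀ κ l m, κ ≠ l → κ ≠ m → A.d l m = A.c κ (A.d l κ * A.d κ m)
  d_self : ∀ κ, A.d κ κ = A.u ⊤
  c_d_mul : ∀ κ l (a : A.carrier), κ ≠ l →
    A.c κ (A.d κ l * A.δ ⊤ a) * A.c κ (A.d κ l * -A.δ ⊤ a) = A.u ⊥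
  δ_one_add : ∀ a b : A.carrier, A.δ ⊤ (A.δ ⊤ a + A.δ ⊤ b) = A.δ ⊤ a + A.δ ⊤ b
  δ_one_mul : ∀ a b : A.carrier, A.δ ⊤ (A.δ ⊤ a * A.δ ⊤ b) = A.δ ⊤ a * A.δ ⊤ b
  δ_one_neg : ∀ a : A.carrier, A.δ ⊤ (-A.δ ⊤ a) = -A.δ ⊤ a
  δ_one_c : ∀ κ (a : A.carrier), A.δ ⊤ (A.c κ (A.δ ⊤ a)) = A.c κ (A.δ ⊤ a)
  δ_one_d : ∀ κ l, A.δ ⊤ (A.d κ l) = A.d κ l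
  δ_zero_d : ∀ κ l, A.δ ⊥ (A.d κ l) = -A.d κ l
  δ_d : ∀ (p : M) κ l, p ≠ ⊥ → p ≠ ⊤ → A.δ p (A.d κ l) = A.u ⊥
  δ_neg : ∀ (p : M) (a : A.carrier), A.δ p (-a) = A.δ pᶜ a
  δ_u_self : ∀ p : M, A.δ p (A.u p) = A.u ⊤
  δ_u_ne : ∀ p q : M, p ≠ q → A.δ p (A.u q) = A.u ⊥
  δ_mul_δ : ∀ (p q : M) (a : A.carrier), p ≠ q → A.δ p a * A.δ q a = A.u ⊥
  sum_δ : ∀ a : A.carrier, base.sum Finset.univ (fun p : M => A.δ p a) = A.u ⊤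
  δ_add : ∀ (p : M) (a b : A.carrier),
    A.δ p (a + b) = base.sum (supPairs p) (fun z => A.δ z.1 a * A.δ z.2 b)
  δ_mul : ∀ (p : M) (a b : A.carrier),
    A.δ p (a * b) = base.sum (infPairs p) (fun z => A.δ z.1 a * A.δ z.2 b)
  δ_one_δ : ∀ (q : M) (a : A.carrier), A.δ ⊤ (A.δ q a) = A.δ q a
  δ_δ : ∀ (p q : M) (a : A.carrier), p ≠ ⊥ → p ≠ ⊤ → A.δ p (A.δ q a) = A.u ⊥
  δ_zero_δ : ∀ (q : M) (a : A.carrier), A.δ ⊥ (A.δ q a) = -A.δ q a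
  δ_ext : ∀ a b : A.carrier, (∀ p : M, A.δ p a = A.δ p b) → a = b
  δ_c : ∀ (p : M) κ (a : A.carrier),
    A.δ p (A.c κ a) =
      base.sum (supEq p) (fun Q => base.prod Q (fun q => A.c κ (A.δ q a))) *
        -base.sum (supGt p) (fun Q => base.prod Q (fun q => A.c κ (A.δ q a)))

/-! ### The algebra `𝔐(𝔅)` -/

/-- The universe of `𝔐(𝔅)`: functions `x : M → B` with `x^p · x^q = 0` for `p ≠ q` and
`∑ x^p = 1`. -/
@[ext]
structure MPartition (M B : Type u) [Fintype M] [BooleanAlgebra B] where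
  val : M → B
  prop : (∀ p q, p ≠ q → val p ⊓ val q = ⊥) ∧ Finset.univ.sup val = ⊤

namespace MPartition

variable {M B : Type u} [Fintype M] [BooleanAlgebra B]

open Classical in
theorem binop_mem (f : M → M → M) (x y : MPartition M B) :
    (∀ p q, p ≠ q →
      (({z | f z.1 z.2 = p} : Finset (M × M)).sup fun z => x.val z.1 ⊓ y.val z.2) ⊓
      (({z | f z.1 z.2 = q} : Finset (M × M)).sup fun z => x.val z.1 ⊓ y.val z.2) = ⊥) ∧
    (Finset.univ.sup fun p =>
      ({z | f z.1 z.2 = p} : Finset (M × M)).sup fun z => x.val z.1 ⊓ y.val z.2) = ⊤ := by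
  constructor
  · intro p q hpq
    rw [← disjoint_iff, Finset.disjoint_sup_left]
    intro z hz
    rw [Finset.disjoint_sup_right]
    intro w hw
    simp only [Finset.mem_filter, Finset.mem_univ, true_and] at hz hw
    rw [disjoint_iff]
    have : z.1 ≠ w.1 ∨ z.2 ≠ w.2 := by
      by_contra! h
      exact hpq (by rw [← hz, ← hw, h.1, h.2])
    rcases this with h | h
    · rw [inf_inf_inf_comm, x.prop.1 _ _ h, bot_inf_eq]
    · rw [inf_inf_inf_comm, y.prop.1 _ _ h, inf_bot_eq]
  · rw [eq_top_iff]
    calc (⊤ : B) = Finset.univ.sup x.val ⊓ Finset.univ.sup y.val := by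
          rw [x.prop.2, y.prop.2, inf_top_eq]
      _ ≤ _ := by
          rw [Finset.sup_inf_sup]
          refine Finset.sup_le fun z _ => ?_
          refine le_trans ?_ (Finset.le_sup (b := f z.1 z.2) (Finset.mem_univ _))
          exact Finset.le_sup (f := fun z : M × M => x.val z.1 ⊓ y.val z.2) (by simp)

theorem neg_mem [DeMorganAlgebra M] (x : MPartition M B) :
    (∀ p q : M, p ≠ q → x.val pᶜ ⊓ x.val qᶜ = ⊥) ∧
      (Finset.univ.sup fun p : M => x.val pᶜ) = ⊤ := by
  constructor
  · intro p q hpq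
    refine x.prop.1 _ _ fun h => hpq ?_
    rw [← DeMorganAlgebra.neg_neg p, h, DeMorganAlgebra.neg_neg]
  · rw [eq_top_iff, ← x.prop.2]
    refine Finset.sup_le fun p _ => ?_
    have := Finset.le_sup (f := fun p : M => x.val pᶜ) (Finset.mem_univ pᶜ)
    simpa only [DeMorganAlgebra.neg_neg] using this

/-- The value at `p` of `𝐜_κ x`, written in terms of `y q = c_κ x^q`. -/
noncomputable def cylFun [DeMorganAlgebra M] (y : M → B) (p : M) : B :=
  ((supEq p).sup fun A => A.inf y) ⊓ ((supGt p).sup fun A => A.inf y)ᶜ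

theorem cylFun_mem [DeMorganAlgebra M] (y : M → B) (hy : Finset.univ.sup y = ⊤) :
    (∀ p q : M, p ≠ q → cylFun y p ⊓ cylFun y q = ⊥) ∧
      Finset.univ.sup (cylFun y) = ⊤ := by
  classical
  constructor
  · intro p q hpq
    unfold cylFun
    rw [inf_inf_inf_comm, ← disjoint_iff, ← compl_sup, disjoint_compl_right_iff,
      Finset.sup_inf_sup]
    refine Finset.sup_le fun z hz => ?_
    simp only [Finset.mem_product, supEq, Finset.mem_filter, Finset.mem_univ, true_and] at hz
    obtain ⟨⟨h1, h2⟩, h3, h4⟩ := hz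
    have hs : (z.1 ∪ z.2).sup id = p ⊔ q := by rw [Finset.sup_union, h2, h4]
    have key : p < p ⊔ q ∨ q < p ⊔ q := by
      by_contra! h
      have e1 : p = p ⊔ q := by
        by_contra hne; exact h.1 (lt_of_le_of_ne le_sup_left hne)
      have e2 : q = p ⊔ q := by
        by_contra hne; exact h.2 (lt_of_le_of_ne le_sup_right hne)
      exact hpq (e1.trans e2.symm)
    have hn : (z.1 ∪ z.2).Nonempty := h1.mono Finset.subset_union_left
    rw [← Finset.inf_union]
    rcases key with h | h
    · refine le_trans ?_ le_sup_left
      exact Finset.le_sup (f := fun A : Finset M => A.inf y) (by simp [supGt, hn, hs, h])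
    · refine le_trans ?_ le_sup_right
      exact Finset.le_sup (f := fun A : Finset M => A.inf y) (by simp [supGt, hn, hs, h])
  · have key : ∀ p : M, ∀ A : Finset M, A.Nonempty → A.sup id = p →
        A.inf y ≤ Finset.univ.sup (cylFun y) := by
      intro p
      induction p using WellFoundedGT.induction with
      | ind p ih =>
        intro A hA hp
        have h1 : A.inf y ≤ (supEq p).sup fun A => A.inf y :=
          Finset.le_sup (f := fun A : Finset M => A.inf y) (by simp [supEq, hA, hp])
        have h2 : ((supGt p).sup fun A => A.inf y) ≤ Finset.univ.sup (cylFun y) := by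
          refine Finset.sup_le fun A' hA' => ?_
          simp only [supGt, Finset.mem_filter, Finset.mem_univ, true_and] at hA'
          exact ih _ hA'.2 A' hA'.1 rfl
        have h3 : cylFun y p ≤ Finset.univ.sup (cylFun y) :=
          Finset.le_sup (Finset.mem_univ p)
        have h4 := sup_le h3 h2
        unfold cylFun at h4
        rw [sup_comm, sup_inf_left, sup_compl_eq_top, inf_top_eq] at h4
        exact h1.trans (le_sup_right.trans h4)
    rw [eq_top_iff, ← hy]
    refine Finset.sup_le fun q _ => ?_
    simpa using key q {q} (by simp) (by simp)

open Classical in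
/-- The constant `𝐮_q`. -/
noncomputable def uElt (q : M) : MPartition M B :=
  ⟨fun p => if p = q then ⊤ else ⊥, by
    constructor
    · intro p r hpr
      by_cases h : p = q
      · have : r ≠ q := fun hr => hpr (h.trans hr.symm)
        simp [this]
      · simp [h]
    · rw [eq_top_iff]
      have := Finset.le_sup (f := fun p => if p = q then (⊤ : B) else ⊥) (Finset.mem_univ q)
      simpa using this⟩

open Classical in
/-- The element with value `b` at `1`, `-b` at `0`, and `0` elsewhere. -/
noncomputable def crisp [DeMorganAlgebra M] [Nontrivial M] (b : B) : MPartition M B :=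
  ⟨fun p => if p = ⊤ then b else if p = ⊥ then bᶜ else ⊥, by
    have hbt : (⊥ : M) ≠ ⊤ := bot_ne_top
    constructor
    · intro p q hpq
      split_ifs <;> simp_all
    · rw [eq_top_iff]
      have h1 := Finset.le_sup (f := fun p : M => if p = ⊤ then b else if p = ⊥ then bᶜ else ⊥)
        (Finset.mem_univ ⊤)
      have h2 := Finset.le_sup (f := fun p : M => if p = ⊤ then b else if p = ⊥ then bᶜ else ⊥)
        (Finset.mem_univ ⊥)
      simp only [hbt, if_true, if_false] at h1 h2
      exact (sup_compl_eq_top (x := b)).symm.le.trans (sup_le h1 h2)⟩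

end MPartition

/-- The algebra `𝔐(𝔅)`. -/
noncomputable def MAlgebraOf (M ι B : Type u) [DeMorganAlgebra M] [Fintype M] [Nontrivial M]
    [BooleanAlgebra B] [CylindricAlgebra ι B] : MCylindricStr M ι where
  carrier := MPartition M B
  add x y := ⟨fun p => (supPairs p).sup fun z => x.val z.1 ⊓ y.val z.2,
    MPartition.binop_mem (· ⊔ ·) x y⟩
  mul x y := ⟨fun p => (infPairs p).sup fun z => x.val z.1 ⊓ y.val z.2,
    MPartition.binop_mem (· ⊓ ·) x y⟩
  neg x := ⟨fun p => x.val pᶜ, x.neg_mem⟩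
  u q := MPartition.uElt q
  c κ x := ⟨MPartition.cylFun fun q => CylindricAlgebra.c κ (x.val q),
    MPartition.cylFun_mem _ (by
      rw [eq_top_iff, ← x.prop.2]
      exact Finset.sup_mono_fun fun q _ => CylindricAlgebra.le_c κ (x.val q))⟩
  d κ l := MPartition.crisp (CylindricAlgebra.d κ l)
  δ q x := MPartition.crisp (x.val q)

/-! ### `M`-cylindric set algebras and representability -/

/-- Subalgebras. -/
structure MCylindricStr.Sub {M ι : Type u} (A : MCylindricStr M ι) where
  carrier : Set A.carrier
  add_mem : ∀ a ∈ carrier, ∀ b ∈ carrier, a + b ∈ carrier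
  mul_mem : ∀ a ∈ carrier, ∀ b ∈ carrier, a * b ∈ carrier
  neg_mem : ∀ a ∈ carrier, -a ∈ carrier
  u_mem : ∀ p, A.u p ∈ carrier
  c_mem : ∀ κ, ∀ a ∈ carrier, A.c κ a ∈ carrier
  d_mem : ∀ κ l, A.d κ l ∈ carrier
  δ_mem : ∀ p, ∀ a ∈ carrier, A.δ p a ∈ carrier

/-- A subalgebra, as an algebra under the restricted operations. -/
def MCylindricStr.Sub.toStr {M ι : Type u} {A : MCylindricStr M ι} (D : A.Sub) :
    MCylindricStr M ι where
  carrier := D.carrier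
  add a b := ⟨a.1 + b.1, D.add_mem _ a.2 _ b.2⟩
  mul a b := ⟨a.1 * b.1, D.mul_mem _ a.2 _ b.2⟩
  neg a := ⟨-a.1, D.neg_mem _ a.2⟩
  u p := ⟨A.u p, D.u_mem p⟩
  c κ a := ⟨A.c κ a.1, D.c_mem κ _ a.2⟩
  d κ l := ⟨A.d κ l, D.d_mem κ l⟩
  δ p a := ⟨A.δ p a.1, D.δ_mem p _ a.2⟩

/-- Homomorphisms. -/
structure MCylindricStr.Hom {M ι : Type u} (A D : MCylindricStr M ι) where
  toFun : A.carrier → D.carrier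
  map_add : ∀ a b, toFun (a + b) = toFun a + toFun b
  map_mul : ∀ a b, toFun (a * b) = toFun a * toFun b
  map_neg : ∀ a, toFun (-a) = -toFun a
  map_u : ∀ p, toFun (A.u p) = D.u p
  map_c : ∀ κ a, toFun (A.c κ a) = D.c κ (toFun a)
  map_d : ∀ κ l, toFun (A.d κ l) = D.d κ l
  map_δ : ∀ p a, toFun (A.δ p a) = D.δ p (toFun a)

/-- An `M`-cylindric set algebra with base `U`: a subalgebra of `𝔐(𝔅)` for some cylindric set
algebra `𝔅` with base `U`. -/
structure MCylindricSetAlgebra (M ι U : Type u) [DeMorganAlgebra M] [Fintype M]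
    [Nontrivial M] where
  setAlgebra : CylindricSetAlgebra ι U
  sub : (MAlgebraOf M ι setAlgebra.Carrier).Sub

/-- `A` is representable: it is isomorphic to a subdirect product of `M`-cylindric set
algebras, i.e. there is a jointly injective family of surjective homomorphisms onto such
algebras. -/
def MCylindricStr.IsRepresentable {M ι : Type u} [DeMorganAlgebra M] [Fintype M] [Nontrivial M]
    (A : MCylindricStr M ι) : Prop :=
  ∃ (J : Type u) (U : J → Type u) (S : ∀ j, MCylindricSetAlgebra M ι (U j))
    (h : ∀ j, A.Hom (S j).sub.toStr),
    (∀ j, Function.Surjective (h j).toFun) ∧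
    (∀ x y : A.carrier, (∀ j, (h j).toFun x = (h j).toFun y) → x = y)

/-! An element `x` of `𝔐(𝔅)` is a partition of unity indexed by `M`. Its threshold at `j`, the join
of the `x^q` with `j ≤ q`, is the Boolean value of `j ≤ x`. A finite distributive lattice is
join-generated by its join-primes, so the thresholds at join-primes determine `x` (`ext_of_thr`). At
a join-prime `j` the threshold commutes with `+`, `·` and, despite its involved definition, with
`c_κ` (`thr_add`, `thr_mul`, `thr_cyl`). Equations in these operations thus reduce to equations in
`𝔅`. The values of `δ_p` and the diagonals are two-valued, and two-valued elements form a copy of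
`𝔅`; this gives the remaining axioms.

A homomorphism from `𝔐(𝔅)` into `𝔐(ℭ)` keeps two-valued elements two-valued, since these are fixed
by `δ_1`. It therefore induces a homomorphism from `𝔅` to `ℭ`, and a representation of `𝔐(𝔅)`
restricts to one of `𝔅`.

For a non-representable `𝔅`, the point `id` of `ι^ι` is split in two. It lies on no diagonal with
distinct indices, so the cylindric axioms survive, whereas in a set algebra the two copies would
have to meet. -/

namespace CylindricAlgebra

/-! ### Monotonicity and additivity of cylindrifications -/

variable {ι B : Type u} [BooleanAlgebra B] [CylindricAlgebra ι B]

theorem c_mono (κ : ι) {x y : B} (h : x ≤ y) : c κ x ≤ c κ y := by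
  have e := c_inf_c κ x y
  rw [inf_eq_left.2 (h.trans (le_c κ y))] at e
  exact inf_eq_left.1 e.symm

theorem c_compl_c (κ : ι) (x : B) : c κ (c κ x)ᶜ = (c κ x)ᶜ := by
  refine le_antisymm ?_ (le_c κ _)
  have e := c_inf_c κ (c κ x)ᶜ x
  rw [compl_inf_eq_bot, c_bot] at e
  exact le_compl_iff_disjoint_right.2 (disjoint_iff.2 e.symm)

/-- The complement of `c κ x ⊔ c κ y` is a meet of two closed elements, hence closed. It is disjoint
from `x ⊔ y`, so `c_inf_c` makes it disjoint from `c κ (x ⊔ y)` too. -/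
theorem c_sup (κ : ι) (x y : B) : c κ (x ⊔ y) = c κ x ⊔ c κ y := by
  refine le_antisymm ?_ (sup_le (c_mono κ le_sup_left) (c_mono κ le_sup_right))
  have hx : c κ (c κ x ⊔ c κ y)ᶜ = (c κ x ⊔ c κ y)ᶜ := by
    rw [compl_sup]
    nth_rw 1 [← c_compl_c κ y]
    rw [c_inf_c, c_compl_c, c_compl_c]
  have e := c_inf_c κ (x ⊔ y) (c κ x ⊔ c κ y)ᶜ
  rw [hx, disjoint_iff.1 (disjoint_compl_right_iff.2 (sup_le_sup (le_c κ x) (le_c κ y))),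
    c_bot] at e
  exact disjoint_compl_right_iff.1 (disjoint_iff.2 e.symm)

theorem c_finset_sup {X : Type*} (κ : ι) (s : Finset X) (f : X → B) :
    c κ (s.sup f) = s.sup fun x => c κ (f x) := by
  classical
  induction s using Finset.induction_on with
  | empty => simpa using c_bot κ
  | insert a s _ ih => rw [Finset.sup_insert, Finset.sup_insert, c_sup, ih]

end CylindricAlgebra

/-! ### Bounds and the De Morgan involution -/

namespace DeMorganAlgebra

variable {M : Type u} [DeMorganAlgebra M]

theorem compl_inj {p q : M} : pᶜ = qᶜ ↔ p = q :=
  ⟨fun h => by rw [← neg_neg p, h, neg_neg], fun h => h ▸ rfl⟩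

theorem compl_bot' : (⊥ : M)ᶜ = ⊤ := by
  have h := neg_sup (⊥ : M) (⊤ : M)ᶜ
  rw [bot_sup_eq, neg_neg, inf_top_eq] at h
  rw [← neg_neg (⊤ : M)]
  refine congrArg _ (le_antisymm bot_le ?_)
  have h2 := neg_inf (⊥ : M)ᶜ (⊤ : M)
  rw [inf_top_eq, neg_neg] at h2
  rw [h2]; exact le_sup_right

theorem compl_top' : (⊤ : M)ᶜ = ⊥ := by
  rw [← compl_bot', neg_neg]

theorem compl_eq_top_iff {p : M} : pᶜ = ⊤ ↔ p = ⊥ := by rw [← compl_bot', compl_inj]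

theorem compl_eq_bot_iff {p : M} : pᶜ = ⊥ ↔ p = ⊤ := by rw [← compl_top', compl_inj]

end DeMorganAlgebra

/-! ### Partitions of unity and their thresholds -/

namespace MPartition

variable {M B : Type u} [Fintype M] [BooleanAlgebra B]

/-- The parts of `x` cover `⊤`, and for `q ≠ p` the part `x^q ≤ y^q` misses `y^p`; so `y^p` lies
under `x^p`. -/
theorem ext_of_le {x y : MPartition M B} (h : ∀ p, x.val p ≤ y.val p) : x = y := by
  classical
  refine MPartition.ext (funext fun p => le_antisymm (h p) ?_)
  calc y.val p = y.val p ⊓ Finset.univ.sup x.val := by rw [x.prop.2, inf_top_eq]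
    _ ≤ x.val p := by
      rw [Finset.sup_inf_distrib_left]
      refine Finset.sup_le fun q _ => ?_
      by_cases hpq : p = q
      · subst hpq; exact inf_le_right
      · refine (inf_le_inf_left _ (h q)).trans ?_
        rw [y.prop.1 p q hpq]; exact bot_le

section Threshold

variable [DeMorganAlgebra M]

open Classical in
/-- The Boolean value of `j ≤ x`. -/
noncomputable def thr (x : MPartition M B) (j : M) : B :=
  ({q | j ≤ q} : Finset M).sup x.val

theorem val_le_thr (x : MPartition M B) {j p : M} (h : j ≤ p) : x.val p ≤ x.thr j :=
  Finset.le_sup (by simpa using h)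

theorem thr_inf_val (x : MPartition M B) {j p : M} (h : ¬ j ≤ p) : x.thr j ⊓ x.val p = ⊥ := by
  rw [← disjoint_iff, thr, Finset.disjoint_sup_left]
  intro q hq
  refine disjoint_iff.2 (x.prop.1 q p ?_)
  rintro rfl
  exact h (by simpa using hq)

/-- If `p ≠ q`, some join-prime `j` lies below exactly one of them. One of `x^p`, `y^q` is then
under the common threshold at `j` and the other is disjoint from it. Hence `x^p` meets only `y^p`.
-/
theorem ext_of_thr {x y : MPartition M B} (h : ∀ j : M, SupPrime j → x.thr j = y.thr j) :
    x = y := by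
  refine ext_of_le fun p => ?_
  calc x.val p = x.val p ⊓ Finset.univ.sup y.val := by rw [y.prop.2, inf_top_eq]
    _ ≤ y.val p := by
      rw [Finset.sup_inf_distrib_left]
      refine Finset.sup_le fun q _ => ?_
      by_cases hpq : p = q
      · subst hpq; exact inf_le_right
      have key : ∀ p q : M, ¬ p ≤ q → ∃ j, SupPrime j ∧ j ≤ p ∧ ¬ j ≤ q := by
        intro p q hle
        by_contra! hc
        obtain ⟨s, rfl, hs⟩ := exists_supIrred_decomposition p
        exact hle (Finset.sup_le fun j hj =>
          hc j (hs hj).supPrime (Finset.le_sup (f := id) hj))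
      have hb : x.val p ⊓ y.val q = ⊥ := by
        rw [← le_bot_iff]
        by_cases hle : p ≤ q
        · obtain ⟨j, hj, h1, h2⟩ := key q p fun h' => hpq (le_antisymm hle h')
          rw [← x.thr_inf_val h2, h j hj, inf_comm]
          exact inf_le_inf_right _ (y.val_le_thr h1)
        · obtain ⟨j, hj, h1, h2⟩ := key p q hle
          rw [← y.thr_inf_val h2, ← h j hj]
          exact inf_le_inf_right _ (x.val_le_thr h1)
      rw [hb]; exact bot_le

open Classical in
theorem thr_binop (f : M → M → M) (x y z : MPartition M B)
    (hz : ∀ p, z.val p = ({w | f w.1 w.2 = p} : Finset (M × M)).sup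
      fun w => x.val w.1 ⊓ y.val w.2) (j : M) :
    z.thr j = ({w | j ≤ f w.1 w.2} : Finset (M × M)).sup fun w => x.val w.1 ⊓ y.val w.2 := by
  refine le_antisymm (Finset.sup_le fun p hp => ?_) (Finset.sup_le fun w hw => ?_)
  · rw [hz]
    refine Finset.sup_mono fun w hw => ?_
    simp only [Finset.mem_filter, Finset.mem_univ, true_and] at hp hw ⊢
    rwa [hw]
  · refine le_trans ?_ (z.val_le_thr (p := f w.1 w.2) (by simpa using hw))
    rw [hz]
    exact Finset.le_sup (f := fun w : M × M => x.val w.1 ⊓ y.val w.2) (by simp)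

theorem thr_uElt (q j : M) [Decidable (j ≤ q)] :
    (uElt q : MPartition M B).thr j = if j ≤ q then ⊤ else ⊥ := by
  split_ifs with h
  · refine top_le_iff.1 (le_trans ?_ (val_le_thr _ h))
    simp [uElt]
  · refine le_bot_iff.1 (Finset.sup_le fun p hp => ?_)
    have : p ≠ q := by rintro rfl; exact h (by simpa using hp)
    simp [uElt, this]

/-- Since the threshold does not depend on `j`, identities between two-valued elements are
identities in `B`. -/
theorem thr_crisp [Nontrivial M] (b : B) {j : M} (hj : j ≠ ⊥) :
    (crisp b : MPartition M B).thr j = b := by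
  refine le_antisymm (Finset.sup_le fun p hp => ?_) ?_
  · have : p ≠ ⊥ := by rintro rfl; exact hj (by simpa using hp)
    by_cases h : p = ⊤ <;> simp [crisp, h, this]
  · refine le_trans ?_ (val_le_thr _ le_top)
    simp [crisp]

open Classical in
-- The terms subtracted at `p` belong to sets with supremum above `p`, hence still above `j`.
-- Downward induction on `p` recovers them from larger components.
theorem sup_cylFun (y : M → B) (j : M) :
    ({q | j ≤ q} : Finset M).sup (cylFun y) =
      ({A | A.Nonempty ∧ j ≤ A.sup id} : Finset (Finset M)).sup fun A => A.inf y := by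
  refine le_antisymm (Finset.sup_le fun p hp => ?_) (Finset.sup_le fun A hA => ?_)
  · refine inf_le_left.trans (Finset.sup_mono fun A hA => ?_)
    simp only [supEq, Finset.mem_filter, Finset.mem_univ, true_and] at hA hp ⊢
    exact ⟨hA.1, hA.2 ▸ hp⟩
  · have key : ∀ p : M, j ≤ p → ∀ A : Finset M, A.Nonempty → A.sup id = p →
        A.inf y ≤ ({q | j ≤ q} : Finset M).sup (cylFun y) := by
      intro p
      induction p using WellFoundedGT.induction with
      | ind p ih =>
        intro hp A hA hAp
        have h1 : A.inf y ≤ (supEq p).sup fun A => A.inf y :=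
          Finset.le_sup (f := fun A : Finset M => A.inf y) (by simp [supEq, hA, hAp])
        have h2 : ((supGt p).sup fun A => A.inf y) ≤
            ({q | j ≤ q} : Finset M).sup (cylFun y) := by
          refine Finset.sup_le fun A' hA' => ?_
          simp only [supGt, Finset.mem_filter, Finset.mem_univ, true_and] at hA'
          exact ih _ hA'.2 (hp.trans hA'.2.le) A' hA'.1 rfl
        have h3 : cylFun y p ≤ ({q | j ≤ q} : Finset M).sup (cylFun y) :=
          Finset.le_sup (by simpa using hp)
        have h4 := sup_le h3 h2
        unfold cylFun at h4
        rw [sup_comm, sup_inf_left, sup_compl_eq_top, inf_top_eq] at h4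
        exact h1.trans (le_sup_right.trans h4)
    simp only [Finset.mem_filter, Finset.mem_univ, true_and] at hA
    exact key _ hA.2 A hA.1 rfl

open Classical in
-- When a join-prime `j` is below the supremum of a finite set, it is below some member, so
-- singletons suffice. This is why thresholds commute with cylindrification.
theorem sup_cylFun_of_supPrime (y : M → B) {j : M} (hj : SupPrime j) :
    ({q | j ≤ q} : Finset M).sup (cylFun y) = ({q | j ≤ q} : Finset M).sup y := by
  rw [sup_cylFun]
  refine le_antisymm (Finset.sup_le fun A hA => ?_) (Finset.sup_le fun q hq => ?_)
  · simp only [Finset.mem_filter, Finset.mem_univ, true_and] at hA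
    obtain ⟨q, hq, hjq⟩ := hj.le_finset_sup.1 hA.2
    exact (Finset.inf_le hq).trans (Finset.le_sup (by simpa using hjq))
  · have := Finset.le_sup (f := fun A : Finset M => A.inf y) (b := {q})
      (s := ({A | A.Nonempty ∧ j ≤ A.sup id} : Finset (Finset M))) (by simpa using hq)
    simpa using this

theorem crisp_injective [Nontrivial M] :
    Function.Injective (crisp : B → MPartition M B) := fun b b' h => by
  simpa [crisp] using congrArg (fun x => x.val ⊤) h

end Threshold

/-! ### Thresholds of the operations, and the two-valued copy of `𝔅` -/

section Operations

variable [DeMorganAlgebra M]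

noncomputable instance : Add (MPartition M B) :=
  ⟨fun x y => ⟨fun p => (supPairs p).sup fun z => x.val z.1 ⊓ y.val z.2,
    binop_mem (· ⊔ ·) x y⟩⟩

noncomputable instance : Mul (MPartition M B) :=
  ⟨fun x y => ⟨fun p => (infPairs p).sup fun z => x.val z.1 ⊓ y.val z.2,
    binop_mem (· ⊓ ·) x y⟩⟩

instance : Neg (MPartition M B) := ⟨fun x => ⟨fun p => x.val pᶜ, x.neg_mem⟩⟩

theorem thr_mul (x y : MPartition M B) (j : M) : (x * y).thr j = x.thr j ⊓ y.thr j := by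
  classical
  rw [thr_binop (· ⊓ ·) x y (x * y) (fun _ => rfl), thr, thr, Finset.sup_inf_sup]
  refine congrArg (Finset.sup · _) (Finset.ext fun w => ?_)
  simp

theorem thr_add (x y : MPartition M B) {j : M} (hj : SupPrime j) :
    (x + y).thr j = x.thr j ⊔ y.thr j := by
  classical
  rw [thr_binop (· ⊔ ·) x y (x + y) (fun _ => rfl)]
  refine le_antisymm (Finset.sup_le fun w hw => ?_) (sup_le ?_ ?_)
  · rcases hj.le_sup.1 ((Finset.mem_filter.1 hw).2) with h | h
    · exact inf_le_left.trans ((x.val_le_thr h).trans le_sup_left)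
    · exact inf_le_right.trans ((y.val_le_thr h).trans le_sup_right)
  · rw [← inf_top_eq (x.thr j), ← y.prop.2, thr, Finset.sup_inf_sup]
    refine Finset.sup_mono fun w hw => ?_
    simp only [Finset.mem_product, Finset.mem_filter, Finset.mem_univ, true_and, and_true] at hw ⊢
    exact hw.trans le_sup_left
  · rw [← top_inf_eq (y.thr j), ← x.prop.2, thr, Finset.sup_inf_sup]
    refine Finset.sup_mono fun w hw => ?_
    simp only [Finset.mem_product, Finset.mem_filter, Finset.mem_univ, true_and] at hw ⊢
    exact hw.trans le_sup_right

/-- The cylindrification `𝐜_κ` of `𝔐(𝔅)`. -/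
noncomputable def cyl {ι : Type u} [CylindricAlgebra ι B] (κ : ι) (x : MPartition M B) :
    MPartition M B :=
  ⟨cylFun fun q => CylindricAlgebra.c κ (x.val q), cylFun_mem _ (by
    rw [eq_top_iff, ← x.prop.2]
    exact Finset.sup_mono_fun fun q _ => CylindricAlgebra.le_c κ (x.val q))⟩

theorem thr_cyl {ι : Type u} [CylindricAlgebra ι B] (κ : ι) (x : MPartition M B) {j : M}
    (hj : SupPrime j) : (x.cyl κ).thr j = CylindricAlgebra.c κ (x.thr j) := by
  classical
  unfold thr
  rw [CylindricAlgebra.c_finset_sup]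
  exact sup_cylFun_of_supPrime _ hj

theorem thr_uElt_bot {j : M} (hj : SupPrime j) : (uElt ⊥ : MPartition M B).thr j = ⊥ := by
  classical
  rw [thr_uElt, if_neg (fun h => hj.ne_bot (le_bot_iff.1 h))]

theorem thr_uElt_top (j : M) : (uElt ⊤ : MPartition M B).thr j = ⊤ := by
  classical
  rw [thr_uElt, if_pos le_top]

theorem add_uElt_bot (x : MPartition M B) : x + uElt ⊥ = x :=
  ext_of_thr fun j hj => by rw [thr_add _ _ hj, thr_uElt_bot hj, sup_bot_eq]

theorem mul_uElt_top (x : MPartition M B) : x * uElt ⊤ = x :=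
  ext_of_thr fun j _ => by rw [thr_mul, thr_uElt_top, inf_top_eq]

variable [Nontrivial M]

theorem crisp_top : (crisp (⊤ : B) : MPartition M B) = uElt ⊤ :=
  ext_of_thr fun j hj => by rw [thr_crisp _ hj.ne_bot, thr_uElt_top]

theorem crisp_bot : (crisp (⊥ : B) : MPartition M B) = uElt ⊥ :=
  ext_of_thr fun j hj => by rw [thr_crisp _ hj.ne_bot, thr_uElt_bot hj]

theorem crisp_sup (a b : B) : (crisp (a ⊔ b) : MPartition M B) = crisp a + crisp b :=
  ext_of_thr fun j hj => by simp only [thr_add _ _ hj, thr_crisp _ hj.ne_bot]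

theorem crisp_inf (a b : B) : (crisp (a ⊓ b) : MPartition M B) = crisp a * crisp b :=
  ext_of_thr fun j hj => by simp only [thr_mul, thr_crisp _ hj.ne_bot]

theorem crisp_c {ι : Type u} [CylindricAlgebra ι B] (κ : ι) (a : B) :
    (crisp (CylindricAlgebra.c κ a) : MPartition M B) = (crisp a).cyl κ :=
  ext_of_thr fun j hj => by simp only [thr_cyl _ _ hj, thr_crisp _ hj.ne_bot]

/-- Negation reverses the order of `M` and has no simple threshold rule, so the components are
compared directly. -/
theorem crisp_compl (a : B) : (crisp aᶜ : MPartition M B) = -crisp a := by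
  refine MPartition.ext (funext fun p => ?_)
  have hbt : (⊥ : M) ≠ ⊤ := bot_ne_top
  change _ = (crisp a : MPartition M B).val pᶜ
  by_cases h : p = ⊤
  · subst h
    simp [crisp, DeMorganAlgebra.compl_top', hbt]
  · by_cases h' : p = ⊥
    · subst h'
      simp [crisp, DeMorganAlgebra.compl_bot', hbt]
    · have h1 : pᶜ ≠ ⊤ := fun e => h' (DeMorganAlgebra.compl_eq_top_iff.1 e)
      have h2 : pᶜ ≠ ⊥ := fun e => h (DeMorganAlgebra.compl_eq_bot_iff.1 e)
      simp [crisp, h, h', h1, h2]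

end Operations

end MPartition


/-! ### The axioms in `𝔐(𝔅)` -/

namespace MAlgebraOf

open MPartition

variable {M ι B : Type u} [DeMorganAlgebra M] [Fintype M] [Nontrivial M]
  [BooleanAlgebra B] [CylindricAlgebra ι B]

theorem isBase : (MAlgebraOf M ι B).IsBase where
  add_comm := fun a b : MPartition M B => show a + b = b + a from
    ext_of_thr fun j hj => by simp only [thr_add _ _ hj, sup_comm]
  mul_comm := fun a b : MPartition M B => show a * b = b * a from
    ext_of_thr fun j _ => by simp only [thr_mul, inf_comm]
  add_assoc := fun a b e : MPartition M B => show (a + b) + e = a + (b + e) from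
    ext_of_thr fun j hj => by simp only [thr_add _ _ hj, sup_assoc]
  mul_assoc := fun a b e : MPartition M B => show (a * b) * e = a * (b * e) from
    ext_of_thr fun j _ => by simp only [thr_mul, inf_assoc]
  mul_add := fun a b e : MPartition M B => show a * (b + e) = a * b + a * e from
    ext_of_thr fun j hj => by simp only [thr_add _ _ hj, thr_mul, inf_sup_left]
  add_mul_distrib := fun a b e : MPartition M B =>
    show a + b * e = (a + b) * (a + e) from
    ext_of_thr fun j hj => by simp only [thr_add _ _ hj, thr_mul, sup_inf_left]
  add_zero := add_uElt_bot (M := M) (B := B)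
  mul_one := mul_uElt_top (M := M) (B := B)

variable (M ι) in
/-- A Boolean element of `B`, as a two-valued element of `𝔐(𝔅)`. -/
noncomputable def ofBool (b : B) : (MAlgebraOf M ι B).carrier := (crisp b : MPartition M B)

variable (ι) in
/-- The component `x^p` of an element of `𝔐(𝔅)`. -/
def comp (x : (MAlgebraOf M ι B).carrier) (p : M) : B := MPartition.val x p

theorem ofBool_injective : Function.Injective (ofBool M ι : B → _) := crisp_injective

theorem ofBool_sup (a b : B) : ofBool M ι (a ⊔ b) = ofBool M ι a + ofBool M ι b := crisp_sup a b

theorem ofBool_inf (a b : B) : ofBool M ι (a ⊓ b) = ofBool M ι a * ofBool M ι b := crisp_inf a b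

theorem ofBool_compl (a : B) : ofBool M ι aᶜ = -ofBool M ι a := crisp_compl a

theorem ofBool_top : ofBool M ι (⊤ : B) = (MAlgebraOf M ι B).u ⊤ := crisp_top

theorem ofBool_bot : ofBool M ι (⊥ : B) = (MAlgebraOf M ι B).u ⊥ := crisp_bot

theorem ofBool_c (κ : ι) (a : B) :
    ofBool M ι (CylindricAlgebra.c κ a) = (MAlgebraOf M ι B).c κ (ofBool M ι a) := crisp_c κ a

theorem d_eq_ofBool (κ l : ι) :
    (MAlgebraOf M ι B).d κ l = ofBool M ι (CylindricAlgebra.d κ l) := rfl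

theorem δ_eq_ofBool (p : M) (x : (MAlgebraOf M ι B).carrier) :
    (MAlgebraOf M ι B).δ p x = ofBool M ι (comp ι x p) := rfl

theorem comp_ofBool_top (b : B) : comp ι (ofBool M ι b) ⊤ = b := by
  simp [comp, ofBool, crisp]

theorem comp_ofBool_bot (b : B) : comp ι (ofBool M ι b) ⊥ = bᶜ := by
  have hbt : (⊥ : M) ≠ ⊤ := bot_ne_top
  simp [comp, ofBool, crisp, hbt]

theorem comp_ofBool_of_ne (b : B) {p : M} (h0 : p ≠ ⊥) (h1 : p ≠ ⊤) :
    comp ι (ofBool M ι b) p = ⊥ := by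
  simp [comp, ofBool, crisp, h0, h1]

theorem sum_ofBool (hA : (MAlgebraOf M ι B).IsBase) {X : Type u} (s : Finset X) (f : X → B) :
    hA.sum s (fun x => ofBool M ι (f x)) = ofBool M ι (s.sup f) := by
  classical
  let := hA.addCommMonoid
  change ∑ x ∈ s, _ = _
  induction s using Finset.induction_on with
  | empty => exact ofBool_bot.symm
  | insert a s ha ih =>
    rw [Finset.sum_insert ha, Finset.sup_insert, ih]
    exact (ofBool_sup _ _).symm

theorem prod_ofBool (hA : (MAlgebraOf M ι B).IsBase) {X : Type u} (s : Finset X) (f : X → B) :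
    hA.prod s (fun x => ofBool M ι (f x)) = ofBool M ι (s.inf f) := by
  classical
  let := hA.commMonoid
  change ∏ x ∈ s, _ = _
  induction s using Finset.induction_on with
  | empty => exact ofBool_top.symm
  | insert a s ha ih =>
    rw [Finset.prod_insert ha, Finset.inf_insert, ih]
    exact (ofBool_inf _ _).symm

/-- Axioms on arbitrary elements under `+`, `·`, `c_κ` are checked on thresholds. Those with `δ_p`
or diagonals become identities in `B` once `ofBool` is pulled outside. -/
theorem isMCylindricAlgebra : (MAlgebraOf M ι B).IsMCylindricAlgebra where
  base := isBase
  δ_add_neg p a := by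
    rw [δ_eq_ofBool, ← ofBool_compl, ← ofBool_sup, sup_compl_eq_top, ofBool_top]
  δ_mul_neg p a := by
    rw [δ_eq_ofBool, ← ofBool_compl, ← ofBool_inf, inf_compl_eq_bot, ofBool_bot]
  c_zero κ := by rw [← ofBool_bot, ← ofBool_c, CylindricAlgebra.c_bot]
  add_c := fun κ (a : MPartition M B) => show a + a.cyl κ = a.cyl κ from
    ext_of_thr fun j hj => by
      rw [thr_add _ _ hj, thr_cyl _ _ hj, sup_eq_right.2 (CylindricAlgebra.le_c κ _)]
  c_mul_c := fun κ (a b : MPartition M B) => show (a * b.cyl κ).cyl κ = a.cyl κ * b.cyl κ from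
    ext_of_thr fun j hj => by
      simp only [thr_mul, thr_cyl _ _ hj, CylindricAlgebra.c_inf_c]
  c_comm := fun κ l (a : MPartition M B) => show (a.cyl l).cyl κ = (a.cyl κ).cyl l from
    ext_of_thr fun j hj => by
      simp only [thr_cyl _ _ hj, CylindricAlgebra.c_comm κ l]
  d_trans κ l m hl hm := by
    simp only [d_eq_ofBool]
    rw [← ofBool_inf, ← ofBool_c, ← CylindricAlgebra.d_trans κ l m hl hm]
  d_self κ := by rw [d_eq_ofBool, CylindricAlgebra.d_self, ofBool_top]
  c_d_mul κ l a h := by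
    simp only [d_eq_ofBool, δ_eq_ofBool]
    rw [← ofBool_compl, ← ofBool_inf, ← ofBool_inf, ← ofBool_c, ← ofBool_c, ← ofBool_inf,
      CylindricAlgebra.c_d_inf κ l _ h, ofBool_bot]
  δ_one_add a b := by
    simp only [δ_eq_ofBool, ← ofBool_sup, comp_ofBool_top]
  δ_one_mul a b := by
    simp only [δ_eq_ofBool, ← ofBool_inf, comp_ofBool_top]
  δ_one_neg a := by
    simp only [δ_eq_ofBool, ← ofBool_compl, comp_ofBool_top]
  δ_one_c κ a := by
    simp only [δ_eq_ofBool, ← ofBool_c, comp_ofBool_top]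
  δ_one_d κ l := by
    simp only [δ_eq_ofBool, d_eq_ofBool, comp_ofBool_top]
  δ_zero_d κ l := by
    simp only [δ_eq_ofBool, d_eq_ofBool, comp_ofBool_bot, ofBool_compl]
  δ_d p κ l h0 h1 := by
    simp only [δ_eq_ofBool, d_eq_ofBool, comp_ofBool_of_ne _ h0 h1, ofBool_bot]
  δ_neg p a := rfl
  δ_u_self p := by
    rw [δ_eq_ofBool, ← ofBool_top]
    exact congrArg _ (if_pos rfl)
  δ_u_ne p q h := by
    rw [δ_eq_ofBool, ← ofBool_bot]
    exact congrArg _ (if_neg h)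
  δ_mul_δ p q a h := by
    rw [δ_eq_ofBool, δ_eq_ofBool, ← ofBool_inf, ← ofBool_bot]
    exact congrArg _ ((MPartition.prop a).1 p q h)
  sum_δ a := by
    simp only [δ_eq_ofBool]
    rw [sum_ofBool, ← ofBool_top]
    exact congrArg _ (MPartition.prop a).2
  δ_add p a b := by
    simp only [δ_eq_ofBool, ← ofBool_inf]
    rw [sum_ofBool]
    rfl
  δ_mul p a b := by
    simp only [δ_eq_ofBool, ← ofBool_inf]
    rw [sum_ofBool]
    rfl
  δ_one_δ q a := by simp only [δ_eq_ofBool, comp_ofBool_top]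
  δ_δ p q a h0 h1 := by
    simp only [δ_eq_ofBool, comp_ofBool_of_ne _ h0 h1, ofBool_bot]
  δ_zero_δ q a := by simp only [δ_eq_ofBool, comp_ofBool_bot, ofBool_compl]
  δ_ext a b h := MPartition.ext (funext fun p => ofBool_injective (h p))
  δ_c p κ a := by
    -- What remains is the definition of the component at `p` of `𝐜_κ a`.
    simp only [δ_eq_ofBool, ← ofBool_c, prod_ofBool, sum_ofBool, ← ofBool_compl, ← ofBool_inf]
    rfl

end MAlgebraOf

/-! ### Representability -/

section Hom

variable {ι B C : Type u} [BooleanAlgebra B] [CylindricAlgebra ι B] [BooleanAlgebra C]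
  [CylindricAlgebra ι C]

/-- The image of a homomorphism of cylindric algebras. -/
def CylindricHom.range (g : CylindricHom ι B C) : CylindricSubalgebra ι C where
  toBool := (⊤ : BooleanSubalgebra B).map g.toBoundedLatticeHom
  c_mem := by
    rintro κ _ ⟨x, -, rfl⟩
    exact ⟨_, trivial, g.map_c κ x⟩
  d_mem κ l := ⟨_, trivial, g.map_d κ l⟩

/-- A homomorphism of cylindric algebras, as a map onto its image. -/
def CylindricHom.rangeRestrict (g : CylindricHom ι B C) :
    CylindricHom ι B g.range.Carrier where
  toFun x := ⟨g.toFun x, x, trivial, rfl⟩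
  map_sup' x y := Subtype.ext (g.map_sup' x y)
  map_inf' x y := Subtype.ext (g.map_inf' x y)
  map_top' := Subtype.ext g.map_top'
  map_bot' := Subtype.ext g.map_bot'
  map_c κ x := Subtype.ext (g.map_c κ x)
  map_d κ l := Subtype.ext (g.map_d κ l)

/-- The composite of a homomorphism into a subalgebra with the inclusion. -/
def CylindricHom.ofSubalgebra {S : CylindricSubalgebra ι C} (g : CylindricHom ι B S.Carrier) :
    CylindricHom ι B C where
  toBoundedLatticeHom := S.toBool.subtype.comp g.toBoundedLatticeHom
  map_c κ x := congrArg Subtype.val (g.map_c κ x)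
  map_d κ l := congrArg Subtype.val (g.map_d κ l)

end Hom

/-- Jointly injective homomorphisms into full cylindric set algebras give a representation. -/
theorem isRepresentableCA_of_homs {ι B : Type u} [BooleanAlgebra B] [CylindricAlgebra ι B]
    {J : Type u} (U : J → Type u) (g : ∀ j, CylindricHom ι B (Set (ι → U j)))
    (hg : ∀ x y : B, (∀ j, (g j).toFun x = (g j).toFun y) → x = y) :
    IsRepresentableCA ι B := by
  refine ⟨J, U, fun j => (g j).range, fun j => (g j).rangeRestrict, ?_, ?_⟩
  · rintro j ⟨_, x, -, rfl⟩
    exact ⟨x, rfl⟩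
  · exact fun x y h => hg x y fun j => congrArg Subtype.val (h j)

/-- Homomorphisms of cylindric algebras into `C`, from homomorphisms of `𝔐(𝔅)` into a subalgebra
of `𝔐(ℭ)`. -/
theorem exists_cylindricHom_of_hom {M ι B C : Type u} [DeMorganAlgebra M] [Fintype M]
    [Nontrivial M] [BooleanAlgebra B] [CylindricAlgebra ι B] [BooleanAlgebra C]
    [CylindricAlgebra ι C] {D : (MAlgebraOf M ι C).Sub} (h : (MAlgebraOf M ι B).Hom D.toStr) :
    ∃ g : CylindricHom ι B C,
      ∀ b, (h.toFun (MAlgebraOf.ofBool M ι b)).1 = MAlgebraOf.ofBool M ι (g.toFun b) := by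
  open MAlgebraOf in
  let f : B → C := fun b => comp ι (h.toFun (ofBool M ι b)).1 ⊤
  -- A two-valued element equals its own `δ_1`, so its image is a value of `δ_1` and again
  -- two-valued.
  have hf : ∀ b, (h.toFun (ofBool M ι b)).1 = ofBool M ι (f b) := fun b => by
    have e := h.map_δ ⊤ (ofBool M ι b)
    rw [δ_eq_ofBool, comp_ofBool_top] at e
    exact congrArg Subtype.val e
  refine ⟨⟨⟨⟨⟨f, ?_⟩, ?_⟩, ?_, ?_⟩, ?_, ?_⟩, hf⟩
  · intro a b
    apply ofBool_injective (M := M) (ι := ι)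
    rw [ofBool_sup, ← hf, ← hf, ← hf, ofBool_sup]
    exact congrArg Subtype.val (h.map_add _ _)
  · intro a b
    apply ofBool_injective (M := M) (ι := ι)
    change ofBool M ι (f (a ⊓ b)) = ofBool M ι (f a ⊓ f b)
    rw [ofBool_inf, ← hf, ← hf, ← hf, ofBool_inf]
    exact congrArg Subtype.val (h.map_mul _ _)
  · apply ofBool_injective (M := M) (ι := ι)
    change ofBool M ι (f ⊤) = _
    rw [← hf, ofBool_top, ofBool_top]
    exact congrArg Subtype.val (h.map_u ⊤)
  · apply ofBool_injective (M := M) (ι := ι)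
    change ofBool M ι (f ⊥) = _
    rw [← hf, ofBool_bot, ofBool_bot]
    exact congrArg Subtype.val (h.map_u ⊥)
  · intro κ a
    apply ofBool_injective (M := M) (ι := ι)
    change ofBool M ι (f (CylindricAlgebra.c κ a)) = ofBool M ι (CylindricAlgebra.c κ (f a))
    rw [ofBool_c, ← hf, ← hf, ofBool_c]
    exact congrArg Subtype.val (h.map_c κ _)
  · intro κ l
    apply ofBool_injective (M := M) (ι := ι)
    change ofBool M ι (f (CylindricAlgebra.d κ l)) = _
    rw [← hf, ← d_eq_ofBool, ← d_eq_ofBool]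
    exact congrArg Subtype.val (h.map_d κ l)

theorem isRepresentableCA_of_mAlgebraOf {M ι B : Type u} [DeMorganAlgebra M] [Fintype M]
    [Nontrivial M] [BooleanAlgebra B] [CylindricAlgebra ι B]
    (hM : (MAlgebraOf M ι B).IsRepresentable) : IsRepresentableCA ι B := by
  obtain ⟨J, U, S, h, -, hinj⟩ := hM
  choose g hg using fun j => exists_cylindricHom_of_hom (h j)
  refine isRepresentableCA_of_homs U (fun j => (g j).ofSubalgebra) fun x y hxy => ?_
  refine MAlgebraOf.ofBool_injective (M := M) (ι := ι) (hinj _ _ fun j => Subtype.ext ?_)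
  rw [hg, hg]
  exact congrArg _ (Subtype.ext (hxy j))

/-! ### A non-representable cylindric algebra in every dimension at least two -/

/-- The points of `ι^ι`, with the point `id` split into two copies. -/
def SplitPoint (ι : Type u) : Type u := Option (ι → ι)

namespace SplitPoint

variable {ι : Type u}

/-- The underlying point of `ι^ι`. -/
def pt (x : SplitPoint ι) : ι → ι := Option.getD x id

/-- The first copy of `id`. -/
def idL : SplitPoint ι := none

/-- The second copy of `id`. -/
def idR : SplitPoint ι := some id

theorem pt_surjective (s : ι → ι) : ∃ x : SplitPoint ι, x.pt = s := ⟨some s, rfl⟩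

/-- Only `id` has two copies, and it is injective, so points on a diagonal with distinct indices are
not split. -/
theorem eq_of_pt_eq {x y : SplitPoint ι} (h : x.pt = y.pt) {κ l : ι} (hκ : κ ≠ l)
    (hx : x.pt κ = x.pt l) : x = y := by
  have hx' : x.pt ≠ id := fun e => hκ (by simpa [e] using hx)
  have hy' : y.pt ≠ id := h ▸ hx'
  match x, y with
  | none, _ => exact absurd rfl hx'
  | some _, none => exact absurd rfl hy'
  | some _, some _ => exact congrArg some h

theorem c_c_subset (κ l : ι) (X : Set (SplitPoint ι)) :
    {x : SplitPoint ι | ∃ y ∈ {x : SplitPoint ι | ∃ y ∈ X, ∀ i ≠ l, x.pt i = y.pt i},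
      ∀ i ≠ κ, x.pt i = y.pt i} ⊆
    {x : SplitPoint ι | ∃ y ∈ {x : SplitPoint ι | ∃ y ∈ X, ∀ i ≠ κ, x.pt i = y.pt i},
      ∀ i ≠ l, x.pt i = y.pt i} := by
  classical
  rintro x ⟨y, ⟨z, hz, hyz⟩, hxy⟩
  by_cases h : κ = l
  · subst h
    exact ⟨z, ⟨z, hz, fun _ _ => rfl⟩, fun i hi => (hxy i hi).trans (hyz i hi)⟩
  -- The fourth corner of the rectangle: it agrees with `x` off `l` and with `z` off `κ`.
  obtain ⟨w, hw⟩ := pt_surjective (Function.update x.pt l (z.pt l))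
  refine ⟨w, ⟨z, hz, fun i hi => ?_⟩, fun i hi => by rw [hw, Function.update_of_ne hi]⟩
  rw [hw]
  by_cases hil : i = l
  · subst hil; rw [Function.update_self]
  · rw [Function.update_of_ne hil, hxy i hi, hyz i hil]

/-- Cylindrifications and diagonals see only underlying points. The one axiom that could tell copies
apart is `c_d_inf`, and it involves only unsplit points. -/
instance : CylindricAlgebra ι (Set (SplitPoint ι)) where
  c κ X := {x | ∃ y ∈ X, ∀ i ≠ κ, x.pt i = y.pt i}
  d κ l := {x | x.pt κ = x.pt l}
  c_bot κ := by ext; simp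
  le_c κ X := fun x hx => ⟨x, hx, fun _ _ => rfl⟩
  c_inf_c κ X Y := by
    ext x
    constructor
    · rintro ⟨y, ⟨hy, z, hz, hyz⟩, hxy⟩
      exact ⟨⟨y, hy, hxy⟩, z, hz, fun i hi => (hxy i hi).trans (hyz i hi)⟩
    · rintro ⟨⟨y, hy, hxy⟩, z, hz, hxz⟩
      exact ⟨y, ⟨hy, z, hz, fun i hi => (hxy i hi).symm.trans (hxz i hi)⟩, hxy⟩
  c_comm κ l X := (c_c_subset κ l X).antisymm (c_c_subset l κ X)
  d_self κ := by ext; simp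
  d_trans κ l m hl hm := by
    classical
    ext x
    constructor
    · intro hx
      obtain ⟨w, hw⟩ := pt_surjective (Function.update x.pt κ (x.pt l))
      have hx : x.pt l = x.pt m := hx
      have h : ∀ i ≠ κ, x.pt i = w.pt i := fun i hi => by rw [hw, Function.update_of_ne hi]
      have hκ : w.pt κ = x.pt l := by rw [hw, Function.update_self]
      refine ⟨w, ⟨?_, ?_⟩, h⟩
      · change w.pt l = w.pt κ
        rw [hκ, h l hl.symm]
      · change w.pt κ = w.pt m
        rw [hκ, hx, h m hm.symm]
    · rintro ⟨y, ⟨h1, h2⟩, h⟩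
      change x.pt l = x.pt m
      rw [h l hl.symm, h m hm.symm]
      exact Eq.trans h1 h2
  c_d_inf κ l X hκ := by
    rw [← disjoint_iff, Set.disjoint_left]
    rintro x ⟨y, ⟨hy, hyX⟩, hxy⟩ ⟨z, ⟨hz, hzX⟩, hxz⟩
    have hy : y.pt κ = y.pt l := hy
    have hz : z.pt κ = z.pt l := hz
    have h : y = z := by
      refine eq_of_pt_eq (funext fun i => ?_) hκ hy
      by_cases hi : i = κ
      · rw [hi, hy, hz, ← hxy l hκ.symm, hxz l hκ.symm]
      · rw [← hxy i hi, hxz i hi]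
    exact hzX (h ▸ hyX)

/-- The relations `h1`, `h2`, `h3` between the copies `a`, `b` of `id` pass to every homomorphic
image. In a set algebra they force each `t` in the image of `a` into the image of the disjoint `b`.
So `a` goes to zero in every set algebra, against joint injectivity. -/
theorem not_isRepresentableCA {κ l : ι} (hκ : κ ≠ l) :
    ¬ IsRepresentableCA ι (Set (SplitPoint ι)) := by
  open CylindricAlgebra in
  classical
  rintro ⟨J, U, S, h, -, hinj⟩
  let a : Set (SplitPoint ι) := {idL}
  let b : Set (SplitPoint ι) := {idR}
  have hab : a ⊓ b = ⊥ := by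
    refine Set.singleton_inter_eq_empty.2 fun e => ?_
    exact Option.some_ne_none _ (Eq.symm e)
  have ha : a ≠ ⊥ := Set.singleton_ne_empty _
  have h1 : a ≤ c l b := by
    rintro _ rfl
    exact ⟨idR, rfl, fun _ _ => rfl⟩
  have h2 : c κ a = c κ b := by
    ext x
    constructor
    · rintro ⟨_, rfl, hx⟩
      exact ⟨idR, rfl, hx⟩
    · rintro ⟨_, rfl, hx⟩
      exact ⟨idL, rfl, hx⟩
  have h3 : c κ b ⊓ c l (d κ l ⊓ c κ b) ≤ d κ l := by
    rintro x ⟨⟨_, rfl, hx⟩, y, ⟨hy, _, rfl, hyb⟩, hxy⟩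
    have hy : y.pt κ = y.pt l := hy
    change x.pt κ = x.pt l
    rw [hxy κ hκ, hy, hyb l hκ.symm, hx l hκ.symm]
  refine ha (hinj _ _ fun j => ?_)
  let g := (h j).ofSubalgebra
  have gmono : ∀ {x y : Set (SplitPoint ι)}, x ≤ y → g.toFun x ⊆ g.toFun y := fun {x y} hxy =>
    OrderHomClass.mono g.toBoundedLatticeHom hxy
  have ginf : ∀ x y, g.toFun (x ⊓ y) = g.toFun x ⊓ g.toFun y := g.map_inf'
  refine Subtype.ext (show g.toFun a = g.toFun ⊥ from ?_)
  have gbot : g.toFun ⊥ = ∅ := g.map_bot'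
  rw [gbot, Set.eq_empty_iff_forall_notMem]
  intro t ht
  have ht1 := gmono h1 ht
  rw [g.map_c] at ht1
  obtain ⟨v, hv⟩ := ht1
  have htA : t ∈ g.toFun (c κ b) := h2 ▸ gmono (le_c κ a) ht
  rw [g.map_c] at htA
  obtain ⟨w, hw⟩ := htA
  -- Here `t(l/v)` and `t(κ/w)` lie in the image of `b`. The point `t(κ/v)` meets both conditions of
  -- `h3`: resetting `κ` to `w` reaches `b`, while setting `l` to `v` lands on the diagonal, from
  -- where resetting `κ` to `t κ` gives `t(l/v)`.
  have key : Function.update t κ v ∈ g.toFun (d κ l) := by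
    refine gmono h3 ?_
    rw [ginf, g.map_c, g.map_c, ginf, g.map_d, g.map_c]
    refine ⟨⟨w, by rwa [Function.update_idem]⟩, v, ?_, t κ, ?_⟩
    · change Function.update (Function.update t κ v) l v κ =
        Function.update (Function.update t κ v) l v l
      rw [Function.update_of_ne hκ, Function.update_self, Function.update_self]
    · rwa [Function.update_comm hκ.symm, Function.update_idem, Function.update_comm hκ,
        Function.update_eq_self_iff.2 (by rw [Function.update_of_ne hκ])]
  rw [g.map_d] at key
  have key : Function.update t κ v κ = Function.update t κ v l := key
  rw [Function.update_self, Function.update_of_ne hκ.symm] at key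
  -- Being on the diagonal means `v = t l`, so `t(l/v)` is `t` itself.
  rw [key, Function.update_eq_self] at hv
  have : t ∈ g.toFun (a ⊓ b) := by rw [ginf]; exact ⟨ht, hv⟩
  rw [hab, gbot] at this
  exact this

end SplitPoint

theorem mainTheorem10 (M : Type u) [DeMorganAlgebra M] [Fintype M] [Nontrivial M]
    (α : Ordinal.{u}) :
    (∀ (B : Type u) [BooleanAlgebra B] [CylindricAlgebra α.ToType B],
      ¬ IsRepresentableCA α.ToType B →
        (MAlgebraOf M α.ToType B).IsMCylindricAlgebra ∧
        ¬ (MAlgebraOf M α.ToType B).IsRepresentable) ∧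
    (2 ≤ α →
      (∃ (B : Type u) (_ : BooleanAlgebra B) (_ : CylindricAlgebra α.ToType B),
        ¬ IsRepresentableCA α.ToType B ∧
        (MAlgebraOf M α.ToType B).IsMCylindricAlgebra ∧
        ¬ (MAlgebraOf M α.ToType B).IsRepresentable) ∧
      ∃ A : MCylindricStr M α.ToType, A.IsMCylindricAlgebra ∧ ¬ A.IsRepresentable) := by
  have hM : ∀ (B : Type u) [BooleanAlgebra B] [CylindricAlgebra α.ToType B],
      ¬ IsRepresentableCA α.ToType B →
        (MAlgebraOf M α.ToType B).IsMCylindricAlgebra ∧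
        ¬ (MAlgebraOf M α.ToType B).IsRepresentable := fun B _ _ hB =>
    ⟨MAlgebraOf.isMCylindricAlgebra, fun h => hB (isRepresentableCA_of_mAlgebraOf h)⟩
  refine ⟨hM, fun hα => ?_⟩
  have hnt : Nontrivial α.ToType := by
    rw [← Cardinal.one_lt_iff_nontrivial, Cardinal.mk_toType]
    have h2 := Ordinal.card_le_card hα
    rw [Ordinal.card_ofNat] at h2
    exact lt_of_lt_of_le (by norm_num) h2
  obtain ⟨κ, l, hκ⟩ := hnt
  have hB := SplitPoint.not_isRepresentableCA hκ
  exact ⟨⟨_, inferInstance, inferInstance, hB, hM _ hB⟩, _, hM _ hB⟩
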